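/- Let $m$ be a positive integer and $\mathcal H$ a complex Hilbert space (of finite or infinite dimension). Let $$P=\mathrm{Isom}(\mathbb C^m,\mathcal H)=\{\varphi\in \mathrm{Hom}(\mathbb C^m,\mathcal H)\mid \varphi^*\varphi=1\}$$ be the Stiefel manifold, a submanifold of the Banach space $\mathrm{Hom}(\mathbb C^m,\mathcal H)$, and let $\mathrm{Gr}_m(\mathcal H)$ be the Grassmann manifold of $m$-dimensional complex subspaces of $\mathcal H$, with the smooth structure induced by the embedding $X\mapsto\mathcal P(X)$ (orthogonal projection onto $X$) into the bounded operators on $\mathcal H$. Let $\pi:P\to \mathrm{Gr}_m(\mathcal H)$, $\pi(\varphi)=\operatorname{Im}\varphi$, let $U(m)$ act on $P$ on the right by $R_g(\varphi)=\varphi\circ g$, and let $\mathfrak u(m)$ be the Lie algebra of $U(m)$. Let $\mathcal A=\varphi^*d\varphi$ be the 1-form on $P$ with $\mathcal A_\varphi(v)=\varphi^*v$ for $v\in T_\varphi P\subset \mathrm{Hom}(\mathbb C^m,\mathcal H)$. Then: 1. $\mathcal A$ takes its values in $\mathfrak u(m)$, which is the space of skew-Hermitian endomorphisms of $\mathbb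 C^m$. 2. For all $g\in U(m)$, $R_g^*\mathcal A=\mathrm{Ad}(g^{-1})\mathcal A$; that is, $dR_g(v)=vg\in T_{\varphi g}P$ and $\mathcal A_{\varphi g}(vg)=g^{-1}\mathcal A_\varphi(v)\,g$ for all $\varphi\in P$, $v\in T_\varphi P$. 3. For all $\varphi\in P$ and $u\in\mathfrak u(m)$, the vector $\varphi u$ lies in $T_\varphi P$ and $\mathcal A_\varphi(\varphi u)=u$. 4. The map $\pi:P\to \mathrm{Gr}_m(\mathcal H)$ is a smooth principal $U(m)$-bundle and $\mathcal A$ is a connection form on it: a smooth $\mathfrak u(m)$-valued 1-form on $P$ with $R_g^*\mathcal A=\mathrm{Ad}(g^{-1})\mathcal A$ for all $g\in U(m)$, and $\mathcal A(\widetilde u)=u$ for all $u\in\mathfrak u(m)$, where $\widetilde u_\varphi=\frac{d}{dt}\big|_{t=0}\,\varphi\exp(tu)$. -/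

import Mathlib

open scoped ContDiff Topology InnerProductSpace

noncomputable section

/-! ## Manifolds embedded in a Banach space

A manifold is given by a type `M` of points with an injection `ι : M → E` into a real Banach space,
whose image is a submanifold; `M` carries the topology and the smooth structure induced by `ι`. -/

namespace Embedded

section Manifolds

variable {M N P E F W : Type*}
  [NormedAddCommGroup E] [NormedSpace ℝ E] [NormedAddCommGroup F] [NormedSpace ℝ F]
  [NormedAddCommGroup W] [NormedSpace ℝ W]

/-- `S ⊆ E` is a smooth (split) submanifold: around each of its points a smooth diffeomorphism
between open subsets of `E` straightens `S` to a closed complemented linear subspace. -/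
def IsSubmanifold (S : Set E) : Prop :=
  ∀ p ∈ S, ∃ (ψ : OpenPartialHomeomorph E E) (K : Submodule ℝ E),
    p ∈ ψ.source ∧ ContDiffOn ℝ ∞ ψ ψ.source ∧ ContDiffOn ℝ ∞ ψ.symm ψ.target ∧
    K.ClosedComplemented ∧ ψ '' (S ∩ ψ.source) = (K : Set E) ∩ ψ.target

/-- `ι` presents `M` as a smooth submanifold of `E`. -/
structure IsManifoldEmbedding (ι : M → E) : Prop where
  injective : Function.Injective ι
  isSubmanifold : IsSubmanifold (Set.range ι)

/-- `f : M → N` is smooth on the subset `s` of `M`: near every point of `s` it is the restriction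
of a smooth map between the ambient spaces. -/
def SmoothOn (ι : M → E) (κ : N → F) (f : M → N) (s : Set M) : Prop :=
  ∀ x ∈ s, ∃ (U : Set E) (f' : E → F), IsOpen U ∧ ι x ∈ U ∧ ContDiffOn ℝ ∞ f' U ∧
    ∀ y ∈ s, ι y ∈ U → κ (f y) = f' (ι y)

/-- Smooth maps between embedded manifolds. -/
def Smooth (ι : M → E) (κ : N → F) (f : M → N) : Prop := SmoothOn ι κ f Set.univ

/-- `v` is the velocity at time `0` of the curve `c` in `M`, which starts at `x` and is smooth near
time `0`. -/
structure HasVelocity (ι : M → E) (x : M) (c : ℝ → M) (v : E) : Prop where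
  start : c 0 = x
  smooth : ContDiffAt ℝ ∞ (fun t => ι (c t)) 0
  velocity : HasDerivAt (fun t => ι (c t)) v 0

/-- The tangent space `T_x M`, as a subspace of the ambient space: it consists of the velocities of
smooth curves in `M` through `x`. (For a submanifold the velocities form a linear subspace, so that
taking the span adds nothing.) -/
def tangentSpace (ι : M → E) (x : M) : Submodule ℝ E :=
  Submodule.span ℝ {v | ∃ c : ℝ → M, HasVelocity ι x c v}

/-- Velocities of curves, as elements of the tangent space. -/
def HasVelocity.toTangent {ι : M → E} {x : M} {c : ℝ → M} {v : E} (h : HasVelocity ι x c v) :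
    tangentSpace ι x :=
  ⟨v, Submodule.subset_span ⟨c, h⟩⟩

/-- `D : T_x M → T_{f x} N` is the differential at `x` of the map `f : M → N`: it maps the velocity
of each curve `c` through `x` to the velocity of `f ∘ c`. -/
def IsDifferentialAt (ι : M → E) (κ : N → F) (f : M → N) (x : M)
    (D : tangentSpace ι x →L[ℝ] tangentSpace κ (f x)) : Prop :=
  ∀ (c : ℝ → M) (v : E) (h : HasVelocity ι x c v),
    HasVelocity κ (f x) (fun t => f (c t)) (D h.toTangent : F)

/-- Differential 1-forms (not yet smooth) on `M` with values in the vector space `W`. -/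
abbrev OneForm (ι : M → E) (W : Type*) [NormedAddCommGroup W] [NormedSpace ℝ W] :=
  ∀ x : M, tangentSpace ι x →L[ℝ] W

/-- Smoothness of a 1-form: near every point it is the restriction of a smooth 1-form on an open
subset of the ambient space. -/
def OneForm.IsSmooth {ι : M → E} (A : OneForm ι W) : Prop :=
  ∀ x : M, ∃ (U : Set E) (η : E → E →L[ℝ] W), IsOpen U ∧ ι x ∈ U ∧ ContDiffOn ℝ ∞ η U ∧
    ∀ y : M, ι y ∈ U → ∀ v : tangentSpace ι y, A y v = η (ι y) v

end Manifolds

/-! ## Principal bundles and connection forms -/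

section Bundles

variable {P B G E F R : Type*}
  [NormedAddCommGroup E] [NormedSpace ℝ E] [NormedAddCommGroup F] [NormedSpace ℝ F]
  [Group G] [NormedRing R] [NormedAlgebra ℝ R]

/-- `γ` presents the group `G` as a linear Lie group, embedded in the Banach algebra `R`. -/
structure IsLieGroupEmbedding (γ : G →* R) : Prop where
  isManifold : IsManifoldEmbedding γ
  smooth_mul : Smooth (Prod.map γ γ) γ (fun x : G × G => x.1 * x.2)
  smooth_inv : Smooth γ γ (fun x : G => x⁻¹)

/-- The Lie algebra `T_1 G` of a linear Lie group. -/
def lieAlgebra (γ : G →* R) : Submodule ℝ R := tangentSpace γ 1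

/-- `π : P → B`, with the right action `act` of `G` on `P`, is a smooth principal `G`-bundle: the
action is smooth, and over a neighbourhood `V` of each point of `B` there is a `G`-equivariant
diffeomorphism `Ψ : V × G → π⁻¹(V)` over `V`, with inverse `p ↦ (π p, τ p)`. -/
structure IsPrincipalBundle (ι : P → E) (κ : B → F) (γ : G →* R)
    (π : P → B) (act : P → G → P) : Prop where
  total : IsManifoldEmbedding ι
  base : IsManifoldEmbedding κ
  group : IsLieGroupEmbedding γ
  smooth_proj : Smooth ι κ π
  act_one : ∀ p, act p 1 = p
  act_mul : ∀ p g h, act p (g * h) = act (act p g) h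
  smooth_act : Smooth (Prod.map ι γ) ι (fun x : P × G => act x.1 x.2)
  locallyTrivial : ∀ b : B, ∃ (V : Set B) (Ψ : B × G → P) (τ : P → G),
    b ∈ V ∧ (∃ O : Set F, IsOpen O ∧ V = κ ⁻¹' O) ∧
    SmoothOn (Prod.map κ γ) ι Ψ (V ×ˢ Set.univ) ∧
    SmoothOn ι γ τ (π ⁻¹' V) ∧
    (∀ b' ∈ V, ∀ g, π (Ψ (b', g)) = b' ∧ τ (Ψ (b', g)) = g) ∧
    (∀ p, π p ∈ V → Ψ (π p, τ p) = p) ∧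
    (∀ b' ∈ V, ∀ g h, Ψ (b', g * h) = act (Ψ (b', g)) h)

/-- `A` is a connection form for the right action `act` of `G` on `P`: a smooth 1-form with values
in the Lie algebra of `G`, with `R_g^* A = Ad(g⁻¹) A` for all `g`, where `R_g = act · g`, and with
`A(ũ) = u` for all `u` in the Lie algebra, where `ũ` is the fundamental vector
`d/dt (p · exp (t u))` at `t = 0`. -/
structure IsConnectionForm (ι : P → E) (γ : G →* R) (act : P → G → P)
    (A : OneForm ι R) : Prop where
  smooth : A.IsSmooth
  mem_lieAlgebra : ∀ p v, A p v ∈ lieAlgebra γ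
  pullback : ∀ (g : G) (p : P),
    ∃ D : tangentSpace ι p →L[ℝ] tangentSpace ι (act p g),
      IsDifferentialAt ι ι (fun q => act q g) p D ∧
      ∀ v, A (act p g) (D v) = γ g⁻¹ * A p v * γ g
  fundamental : ∀ u ∈ lieAlgebra γ, ∀ p : P,
    ∃ a : ℝ → G, (∀ t, γ (a t) = NormedSpace.exp (t • u)) ∧
      ∃ (w : E) (h : HasVelocity ι p (fun t => act p (a t)) w), A p h.toTangent = u

end Bundles

end Embedded

/-! ## The Stiefel manifold and the Grassmann manifold -/

/-- `ℂ^m` with its standard Hermitian structure. -/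
abbrev Cm (m : ℕ) := EuclideanSpace ℂ (Fin m)

/-- `U(m)`, the group of unitary transformations of `ℂ^m`. -/
abbrev Um (m : ℕ) := unitary (Cm m →L[ℂ] Cm m)

/-- The inclusion of `U(m)` in the algebra of endomorphisms of `ℂ^m`. -/
def Um.incl (m : ℕ) : Um m →* (Cm m →L[ℂ] Cm m) := (unitary (Cm m →L[ℂ] Cm m)).subtype

/-- `Gr_m(H)`: the `m`-dimensional complex subspaces of `H`. -/
def Gr (m : ℕ) (H : Type*) [NormedAddCommGroup H] [InnerProductSpace ℂ H] :=
  {X : Submodule ℂ H // FiniteDimensional ℂ X ∧ Module.finrank ℂ X = m}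

section Spaces

variable (m : ℕ) (H : Type*) [NormedAddCommGroup H] [InnerProductSpace ℂ H] [CompleteSpace H]

/-- `Isom(ℂ^m, H)`, the Stiefel manifold: the linear maps `φ : ℂ^m → H` with `φ^* φ = 1`. -/
def Stiefel := {φ : Cm m →L[ℂ] H // φ.adjoint ∘L φ = ContinuousLinearMap.id ℂ (Cm m)}

variable {m H}

/-- The inclusion of `Isom(ℂ^m, H)` in `Hom(ℂ^m, H)`. -/
def Stiefel.incl (φ : Stiefel m H) : Cm m →L[ℂ] H := φ.1

/-- The embedding of `Gr_m(H)` in the operators on `H`, which maps a subspace to the orthogonal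
projection on it. -/
def Gr.proj (X : Gr m H) : H →L[ℂ] H :=
  haveI := X.2.1
  X.1.starProjection

theorem Stiefel.injective (φ : Stiefel m H) : Function.Injective φ.1 :=
  Function.LeftInverse.injective (g := φ.1.adjoint) fun x => by
    simpa using congrArg (fun f : Cm m →L[ℂ] Cm m => f x) φ.2

/-- The bundle projection `π(φ) = im φ`. -/
def Stiefel.toGr (φ : Stiefel m H) : Gr m H :=
  ⟨LinearMap.range (φ.1 : Cm m →ₗ[ℂ] H), inferInstance, by
    rw [LinearMap.finrank_range_of_inj φ.injective]; simp⟩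

theorem Stiefel.comp_isometry (φ : Stiefel m H) (g : Um m) :
    (φ.1 ∘L (g : Cm m →L[ℂ] Cm m)).adjoint ∘L (φ.1 ∘L (g : Cm m →L[ℂ] Cm m)) =
      ContinuousLinearMap.id ℂ (Cm m) := by
  ext1 x
  have h1 (y : Cm m) : φ.1.adjoint (φ.1 y) = y := congrArg (fun f : Cm m →L[ℂ] Cm m => f y) φ.2
  have h2 : (g : Cm m →L[ℂ] Cm m).adjoint ((g : Cm m →L[ℂ] Cm m) x) = x :=
    congrArg (fun f : Cm m →L[ℂ] Cm m => f x) (Unitary.star_mul_self_of_mem g.2)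
  rw [ContinuousLinearMap.adjoint_comp]
  simp only [ContinuousLinearMap.comp_apply, h1, h2, ContinuousLinearMap.id_apply]

/-- The right action `φ ↦ φ ∘ g` of `U(m)`. -/
def Stiefel.act (φ : Stiefel m H) (g : Um m) : Stiefel m H :=
  ⟨φ.1 ∘L (g : Cm m →L[ℂ] Cm m), φ.comp_isometry g⟩

/-- The 1-form `A = φ^* dφ` on `Isom(ℂ^m, H)`: its value on a tangent vector `v` at `φ` is
`φ^* ∘ v`. -/
def Stiefel.form : Embedded.OneForm (Stiefel.incl (m := m) (H := H)) (Cm m →L[ℂ] Cm m) :=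
  fun φ => ((ContinuousLinearMap.compL ℂ (Cm m) H (Cm m) φ.1.adjoint).restrictScalars ℝ).comp
    (Embedded.tangentSpace Stiefel.incl φ).subtypeL

end Spaces

/-- `𝔲(m)`: the skew-Hermitian endomorphisms of `ℂ^m`. -/
def skewHermitian (m : ℕ) : Submodule ℝ (Cm m →L[ℂ] Cm m) :=
  skewAdjoint.submodule ℝ (Cm m →L[ℂ] Cm m)

end

/-! The identities for the form are short computations. Differentiating `c^* c = 1` along a curve of
isometries makes `φ^* v` skew-Hermitian; `(φ g)^* (v g) = g⁻¹ (φ^* v) g`; `φ^* φ u = u`; and `exp (t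
u)` realises `u` and `φ u` as velocities.

The substance is the manifold structures and local triviality. Both rest on one device, the polar
retraction `ρ(V) = V (V^* V)^{-1/2}` of `exists_smooth_polar`: it is smooth on a neighbourhood of
all isometries, isometry-valued, and fixes isometries. Its square root is a local inverse of
squaring at `1`, given by the inverse function theorem. By `isSubmanifold_of_retraction`, `ρ` makes
the Stiefel manifold a submanifold, and also `U(m)`, which is the case `H = ℂ^m`. For fixed `φ₀` and
the projection `P_X` near that onto the image of `φ₀`, the isometry `ρ(P_X φ₀)` has the form `P_X φ₀
a`, so its image lies in `X` and equals `X` by dimension. This gives local sections `s` of `π`.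
Following `A ↦ ρ(A φ₀)` by `φ ↦ φ φ^*` gives retractions onto the Grassmannian. A section
trivialises the bundle by `(X, g) ↦ s(X) g`, with group coordinate `s(π φ)^* φ`. -/

noncomputable section

namespace Embedded

/-! ### Local diffeomorphisms and images of smooth retractions -/

section Local

variable {E : Type*} [NormedAddCommGroup E] [NormedSpace ℝ E] [CompleteSpace E]

/-- Inverse function theorem for smooth maps, with smoothness on whole neighbourhoods. -/
theorem exists_local_diffeo {f : E → E} {U : Set E} {p : E} (hU : IsOpen U) (hp : p ∈ U)
    (hf : ContDiffOn ℝ ∞ f U) (e : E ≃L[ℝ] E) (he : HasFDerivAt f (e : E →L[ℝ] E) p) :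
    ∃ ψ : OpenPartialHomeomorph E E, p ∈ ψ.source ∧ ψ.source ⊆ U ∧ (∀ x, ψ x = f x) ∧
      ContDiffOn ℝ ∞ ψ ψ.source ∧ ContDiffOn ℝ ∞ ψ.symm ψ.target := by
  have hfp : ContDiffAt ℝ ∞ f p := hf.contDiffAt (hU.mem_nhds hp)
  set ψ₀ := hfp.toOpenPartialHomeomorph f he (by simp)
  have hcont : ContinuousOn (fderiv ℝ f) U := hf.continuousOn_fderiv_of_isOpen hU (by simp)
  -- Shrinking to the open set of points with invertible derivative makes the inverse smooth on its
  -- whole domain, not just at the image of `p`.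
  have hop : IsOpen (U ∩ fderiv ℝ f ⁻¹' Set.range ((↑) : (E ≃L[ℝ] E) → E →L[ℝ] E)) :=
    hcont.isOpen_inter_preimage hU ContinuousLinearEquiv.isOpen
  set O := U ∩ fderiv ℝ f ⁻¹' Set.range ((↑) : (E ≃L[ℝ] E) → E →L[ℝ] E)
  have hpO : p ∈ O := ⟨hp, e, he.fderiv.symm⟩
  have hsrc : (ψ₀.restrOpen O hop).source = ψ₀.source ∩ O := ψ₀.restrOpen_source O hop
  have hcoe : ∀ x, ψ₀.restrOpen O hop x = f x := fun x => rfl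
  have hcoe' : (ψ₀.restrOpen O hop : E → E) = f := rfl
  refine ⟨ψ₀.restrOpen O hop, ?_, ?_, hcoe, ?_, ?_⟩
  · rw [hsrc]
    exact ⟨hfp.mem_toOpenPartialHomeomorph_source he (by simp), hpO⟩
  · rw [hsrc]
    exact fun x hx => hx.2.1
  · rw [hcoe', hsrc]
    exact hf.mono fun x hx => hx.2.1
  · intro y hy
    have hx := (ψ₀.restrOpen O hop).map_target hy
    rw [hsrc] at hx
    obtain ⟨e', he'⟩ := hx.2.2
    have hfx : ContDiffAt ℝ ∞ f ((ψ₀.restrOpen O hop).symm y) :=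
      hf.contDiffAt (hU.mem_nhds hx.2.1)
    refine ((ψ₀.restrOpen O hop).contDiffAt_symm (f₀' := e') hy ?_ hfx).contDiffWithinAt
    rw [hcoe', he']
    exact (hfx.differentiableAt (by simp)).hasFDerivAt

/-- A set that is locally the image of a smooth retraction of an open set is a submanifold. -/
theorem isSubmanifold_of_retraction {S : Set E}
    (h : ∀ p ∈ S, ∃ (U : Set E) (r : E → E), IsOpen U ∧ p ∈ U ∧ ContDiffOn ℝ ∞ r U ∧
      (∀ x ∈ U, r x ∈ S) ∧ ∀ x ∈ U, x ∈ S → r x = x) :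
    IsSubmanifold S := by
  intro p hpS
  obtain ⟨U, r, hU, hpU, hr, hrS, hrid⟩ := h p hpS
  have hrp : r p = p := hrid p hpU hpS
  have hrp' : ContDiffAt ℝ ∞ r p := hr.contDiffAt (hU.mem_nhds hpU)
  set R := fderiv ℝ r p
  have hR : HasStrictFDerivAt r R p := hrp'.hasStrictFDerivAt (by simp)
  have hrt : Filter.Tendsto r (𝓝 p) (𝓝 p) := by
    simpa [hrp, ContinuousAt] using hrp'.continuousAt
  have hUn : ∀ᶠ x in 𝓝 p, x ∈ U := hU.mem_nhds hpU
  have hrU : ∀ᶠ x in 𝓝 p, r x ∈ U := hrt hUn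
  -- Differentiating `r ∘ r = r` at the fixed point `p`: the derivative is a projection.
  have hRR : ∀ v, R (R v) = R v := by
    have h1 : HasFDerivAt (fun x => r (r x)) (R.comp R) p :=
      HasFDerivAt.comp p (by rw [hrp]; exact hR.hasFDerivAt) hR.hasFDerivAt
    have h2 : HasFDerivAt (fun x => r (r x)) R p := by
      refine hR.hasFDerivAt.congr_of_eventuallyEq ?_
      filter_upwards [hUn, hrU] with x hx hx'
      exact hrid _ hx' (hrS x hx)
    exact fun v => congrArg (fun L : E →L[ℝ] E => L v) (h1.unique h2)
  -- Strict differentiability compares the two moving points `x` and `r x`. Any constant below `1`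
  -- would serve.
  have hlo : ∀ᶠ x in 𝓝 p, ‖r x - r (r x) - R (x - r x)‖ ≤ 1 / 2 * ‖x - r x‖ := by
    have ht : Filter.Tendsto (fun x => (x, r x)) (𝓝 p) (𝓝 (p, p)) := by
      rw [nhds_prod_eq]
      exact Filter.tendsto_id.prodMk hrt
    exact ht (hR.isLittleO.def (by norm_num : (0 : ℝ) < 1 / 2))
  obtain ⟨O, hO, hOop, hpO⟩ := eventually_nhds_iff.1 (hUn.and (hrU.and hlo))
  set Q : E →L[ℝ] E := ContinuousLinearMap.id ℝ E - R
  have hQR : ∀ v, Q (R v) = 0 := fun v => by simp [Q, hRR]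
  have hQQ : ∀ v, Q (Q v) = Q v := fun v => by simp [Q, hRR]
  -- The straightening map: tangential part of `x - p` plus normal part of the defect `x - r x`. Its
  -- derivative at `p` is `R + Q (1 - R) = R + Q = 1`.
  set f : E → E := fun x => R (x - p) + Q (x - r x)
  have hf : ContDiffOn ℝ ∞ f O := by
    have hr' : ContDiffOn ℝ ∞ r O := hr.mono fun x hx => (hO x hx).1
    exact (R.contDiff.comp_contDiffOn (contDiffOn_id.sub contDiffOn_const)).add
      (Q.contDiff.comp_contDiffOn (contDiffOn_id.sub hr'))
  have hfd : HasFDerivAt f ((ContinuousLinearEquiv.refl ℝ E : E ≃L[ℝ] E) : E →L[ℝ] E) p := by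
    have h1 : HasFDerivAt f (R.comp (ContinuousLinearMap.id ℝ E) + Q.comp Q) p :=
      (R.hasFDerivAt.comp p ((hasFDerivAt_id p).sub_const p)).add
        (Q.hasFDerivAt.comp p ((hasFDerivAt_id p).sub hR.hasFDerivAt))
    refine h1.congr_fderiv ?_
    ext v
    simp [hQQ]
    simp [Q]
  obtain ⟨ψ, hpψ, hψO, hψf, hψ, hψs⟩ := exists_local_diffeo hOop hpO hf _ hfd
  have key : ∀ x ∈ O, x ∈ S ↔ f x ∈ LinearMap.ker (Q : E →ₗ[ℝ] E) := by
    intro x hx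
    have hQf : Q (f x) = Q (x - r x) := by simp only [f, map_add, hQR, hQQ, zero_add]
    rw [LinearMap.mem_ker, ContinuousLinearMap.coe_coe, hQf]
    obtain ⟨hxU, hrxU, hle⟩ := hO x hx
    constructor
    · intro hxS
      rw [hrid x hxU hxS, sub_self, map_zero]
    -- Here `R` fixes the defect `x - r x`, while `r` takes the same value at `x` and `r x`. The
    -- estimate becomes `‖x - r x‖ ≤ ½ ‖x - r x‖`, so `x = r x`.
    · intro h0
      have h1 : R (x - r x) = x - r x := by
        have : (x - r x) - R (x - r x) = 0 := h0
        exact (sub_eq_zero.1 this).symm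
      rw [hrid _ hrxU (hrS x hxU), h1, sub_self, zero_sub, norm_neg] at hle
      have h2 : ‖x - r x‖ = 0 := by linarith [norm_nonneg (x - r x)]
      rw [sub_eq_zero.1 (norm_eq_zero.1 h2)]
      exact hrS x hxU
  refine ⟨ψ, LinearMap.ker (Q : E →ₗ[ℝ] E), hpψ, hψ, hψs,
    ⟨R.codRestrict _ fun v => hQR v, fun x => ?_⟩, ?_⟩
  · have : (x : E) - R x = 0 := x.2
    exact Subtype.ext (sub_eq_zero.1 this).symm
  · ext y
    constructor
    · rintro ⟨x, ⟨hxS, hx⟩, rfl⟩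
      refine ⟨?_, ψ.map_source hx⟩
      rw [hψf]
      exact (key x (hψO hx)).1 hxS
    · rintro ⟨hyK, hy⟩
      refine ⟨ψ.symm y, ⟨(key _ (hψO (ψ.map_target hy))).2 ?_, ψ.map_target hy⟩,
        ψ.right_inv hy⟩
      rw [← hψf, ψ.right_inv hy]
      exact hyK

end Local

end Embedded

/-! ### Square roots and the polar retraction -/

/-- A smooth square root near `1` in a complete star algebra. -/
theorem exists_smooth_sqrt (A : Type*) [NormedRing A] [NormedAlgebra ℝ A] [CompleteSpace A]
    [StarRing A] [ContinuousStar A] :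
    ∃ (O : Set A) (σ : A → A), IsOpen O ∧ 1 ∈ O ∧ ContDiffOn ℝ ∞ σ O ∧ σ 1 = 1 ∧
      (∀ a ∈ O, IsUnit a) ∧ (∀ a ∈ O, σ a * σ a = a) ∧ ∀ a ∈ O, star a = a → star (σ a) = σ a := by
  let e : A ≃L[ℝ] A := ContinuousLinearEquiv.smulLeft (Units.mk0 (2 : ℝ) two_ne_zero)
  have hsq : ContDiffOn ℝ ∞ (fun a : A => a * a) Set.univ :=
    (contDiff_id.mul contDiff_id).contDiffOn
  have hd : HasFDerivAt (fun a : A => a * a) (e : A →L[ℝ] A) 1 := by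
    refine ((hasFDerivAt_id (𝕜 := ℝ) (1 : A)).mul' (hasFDerivAt_id (𝕜 := ℝ) (1 : A))).congr_fderiv ?_
    ext v
    simp [e, two_smul, Units.smul_def]
  obtain ⟨ψ, h1, -, hψ, -, hs⟩ :=
    Embedded.exists_local_diffeo isOpen_univ (Set.mem_univ (1 : A)) hsq e hd
  have hσ1 : ψ.symm 1 = 1 := by
    have := ψ.left_inv h1
    rwa [hψ, one_mul] at this
  have h1t : (1 : A) ∈ ψ.target := by
    have := ψ.map_source h1
    rwa [hψ, one_mul] at this
  -- Requiring the adjoint of the root to stay in the domain where squaring is injective makes roots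
  -- of self-adjoint elements self-adjoint: both the root and its adjoint square to `a`.
  have hO : IsOpen (ψ.target ∩ ψ.symm ⁻¹' (star ⁻¹' ψ.source)) :=
    ψ.symm.isOpen_inter_preimage (ψ.open_source.preimage continuous_star)
  have hroot : ∀ a ∈ ψ.target, ψ.symm a * ψ.symm a = a := fun a ha => by
    rw [← hψ, ψ.right_inv ha]
  refine ⟨(ψ.target ∩ ψ.symm ⁻¹' (star ⁻¹' ψ.source)) ∩ {a | IsUnit a}, ψ.symm,
    hO.inter Units.isOpen, ⟨⟨h1t, by simpa [hσ1] using h1⟩, isUnit_one⟩,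
    hs.mono fun a ha => ha.1.1, hσ1, fun a ha => ha.2, fun a ha => hroot a ha.1.1, ?_⟩
  intro a ha hsa
  refine ψ.injOn ha.1.2 (ψ.map_target ha.1.1) ?_
  rw [hψ, hψ, ← star_mul, hroot a ha.1.1, hsa]

section Operators

variable {X E F G : Type*} [NormedAddCommGroup X] [NormedSpace ℝ X]
  [NormedAddCommGroup E] [InnerProductSpace ℂ E]
  [NormedAddCommGroup F] [InnerProductSpace ℂ F]
  [NormedAddCommGroup G] [InnerProductSpace ℂ G]

/-- Composition of complex operators, as a real bilinear map. -/
theorem contDiff_complex_comp :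
    ContDiff ℝ ∞ fun p : (F →L[ℂ] G) × (E →L[ℂ] F) => p.1 ∘L p.2 :=
  (isBoundedBilinearMap_comp (𝕜 := ℂ)).contDiff.restrict_scalars ℝ

theorem ContDiffOn.complex_comp {f : X → F →L[ℂ] G} {g : X → E →L[ℂ] F} {s : Set X}
    (hf : ContDiffOn ℝ ∞ f s) (hg : ContDiffOn ℝ ∞ g s) :
    ContDiffOn ℝ ∞ (fun x => f x ∘L g x) s :=
  contDiff_complex_comp.comp_contDiffOn (hf.prodMk hg)

/-- Left composition as a real-linear map. -/
def realCompL (f : F →L[ℂ] G) : (E →L[ℂ] F) →L[ℝ] (E →L[ℂ] G) :=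
  (ContinuousLinearMap.compL ℂ E F G f).restrictScalars ℝ

/-- Right composition as a real-linear map. -/
def realCompR (g : E →L[ℂ] F) : (F →L[ℂ] G) →L[ℝ] (E →L[ℂ] G) :=
  ((ContinuousLinearMap.compL ℂ E F G).flip g).restrictScalars ℝ

variable [CompleteSpace E] [CompleteSpace F]

/-- The adjoint as a real-linear map. -/
def realAdjoint : (E →L[ℂ] F) →L[ℝ] (F →L[ℂ] E) where
  toFun f := f.adjoint
  map_add' f g := map_add _ f g
  map_smul' c f := by
    have h := (ContinuousLinearMap.adjoint (𝕜 := ℂ) (E := E) (F := F)).map_smulₛₗ (c : ℂ) f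
    simpa using h
  cont := (ContinuousLinearMap.adjoint (𝕜 := ℂ) (E := E) (F := F)).continuous

theorem ContDiffOn.complex_adjoint {f : X → E →L[ℂ] F} {s : Set X} (hf : ContDiffOn ℝ ∞ f s) :
    ContDiffOn ℝ ∞ (fun x => (f x).adjoint) s :=
  (realAdjoint (E := E) (F := F)).contDiff.comp_contDiffOn hf

/-- The isometric part of the polar decomposition is a smooth retraction of a neighbourhood of the
isometries onto the isometries. -/
theorem exists_smooth_polar (E F : Type*)
    [NormedAddCommGroup E] [InnerProductSpace ℂ E] [CompleteSpace E]
    [NormedAddCommGroup F] [InnerProductSpace ℂ F] [CompleteSpace F] :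
    ∃ (Ω : Set (E →L[ℂ] F)) (ρ : (E →L[ℂ] F) → E →L[ℂ] F), IsOpen Ω ∧ ContDiffOn ℝ ∞ ρ Ω ∧
      (∀ V ∈ Ω, (ρ V).adjoint ∘L ρ V = ContinuousLinearMap.id ℂ E) ∧
      (∀ V : E →L[ℂ] F, V.adjoint ∘L V = ContinuousLinearMap.id ℂ E → V ∈ Ω ∧ ρ V = V) ∧
      ∀ V ∈ Ω, ∃ a : E →L[ℂ] E, ρ V = V ∘L a := by
  obtain ⟨O, σ, hO, h1O, hσ, hσ1, hunit, hroot, hstar⟩ := exists_smooth_sqrt (E →L[ℂ] E)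
  have hgram : ContDiffOn ℝ ∞ (fun V : E →L[ℂ] F => V.adjoint ∘L V) Set.univ :=
    contDiffOn_id.complex_adjoint.complex_comp contDiffOn_id
  have hσu : ∀ a ∈ O, IsUnit (σ a) := fun a ha => by
    have := hunit a ha
    rw [← hroot a ha] at this
    exact ((Commute.refl _).isUnit_mul_iff.1 this).1
  -- The witness is `ρ(V) = V (V^* V)^{-1/2}`, on the set where `V^* V` lies in the domain of the
  -- square root.
  refine ⟨(fun V : E →L[ℂ] F => V.adjoint ∘L V) ⁻¹' O,
    fun V => V ∘L Ring.inverse (σ (V.adjoint ∘L V)), ?_, ?_, ?_, ?_, fun V _ => ⟨_, rfl⟩⟩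
  · exact hO.preimage (continuousOn_univ.1 hgram.continuousOn)
  · refine contDiffOn_id.complex_comp ?_
    have h1 : ContDiffOn ℝ ∞ (fun V : E →L[ℂ] F => σ (V.adjoint ∘L V))
        ((fun V : E →L[ℂ] F => V.adjoint ∘L V) ⁻¹' O) :=
      hσ.comp (hgram.mono (Set.subset_univ _)) fun V hV => hV
    intro V hV
    obtain ⟨u, hu⟩ := hσu _ hV
    have h2 : ContDiffAt ℝ ∞ Ring.inverse (σ (V.adjoint ∘L V)) := by
      rw [← hu]
      exact contDiffAt_ringInverse ℝ u
    exact h2.comp_contDiffWithinAt V (h1 V hV)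
  · intro V hV
    have hV' : V.adjoint ∘L V ∈ O := hV
    set h := V.adjoint ∘L V
    have hh : star h = h := by
      rw [ContinuousLinearMap.star_eq_adjoint, ContinuousLinearMap.adjoint_comp,
        ContinuousLinearMap.adjoint_adjoint]
    have hs : star (Ring.inverse (σ h)) = Ring.inverse (σ h) := by
      rw [← Ring.inverse_star, hstar h hV' hh]
    have h3 : Ring.inverse (σ h) * (h * Ring.inverse (σ h)) = 1 := by
      nth_rewrite 2 [← hroot h hV']
      rw [mul_assoc, Ring.mul_inverse_cancel _ (hσu h hV'), mul_one,
        Ring.inverse_mul_cancel _ (hσu h hV')]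
    rw [ContinuousLinearMap.adjoint_comp, ← ContinuousLinearMap.star_eq_adjoint, hs]
    exact h3
  · intro V hV
    constructor
    · rw [Set.mem_preimage, hV]
      exact h1O
    · have : σ (ContinuousLinearMap.id ℂ E) = 1 := hσ1
      dsimp only
      rw [hV, this, Ring.inverse_one]
      exact ContinuousLinearMap.comp_id V

end Operators

/-! ### Subspaces, projections and isometric frames -/

section Subspaces

variable {m : ℕ} {H : Type*} [NormedAddCommGroup H] [InnerProductSpace ℂ H]

theorem Gr.proj_mem (X : Gr m H) (v : H) : X.proj v ∈ X.1 := by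
  have := X.2.1
  exact Submodule.coe_mem (X.1.orthogonalProjectionOnto v)

theorem Gr.proj_eq_self (X : Gr m H) {v : H} (hv : v ∈ X.1) : X.proj v = v := by
  have := X.2.1
  exact Submodule.starProjection_eq_self_iff.2 hv

theorem Gr.proj_injective : Function.Injective (Gr.proj (m := m) (H := H)) := by
  intro X Y h
  refine Subtype.ext (le_antisymm (fun v hv => ?_) fun v hv => ?_)
  · rw [← X.proj_eq_self hv, h]
    exact Y.proj_mem v
  · rw [← Y.proj_eq_self hv, ← h]
    exact X.proj_mem v

variable [CompleteSpace H]

theorem Stiefel.adjoint_apply_apply (φ : Stiefel m H) (x : Cm m) : φ.1.adjoint (φ.1 x) = x :=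
  congrArg (fun f : Cm m →L[ℂ] Cm m => f x) φ.2

theorem Stiefel.incl_injective : Function.Injective (Stiefel.incl (m := m) (H := H)) :=
  Subtype.val_injective

theorem Stiefel.range_incl : Set.range (Stiefel.incl (m := m) (H := H)) =
    {φ | φ.adjoint ∘L φ = ContinuousLinearMap.id ℂ (Cm m)} :=
  Subtype.range_val

theorem Stiefel.mem_toGr (φ : Stiefel m H) (x : Cm m) : φ.1 x ∈ φ.toGr.1 :=
  LinearMap.mem_range_self (φ.1 : Cm m →ₗ[ℂ] H) x

/-- Both spaces have dimension `m`, so one inclusion suffices. -/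
theorem Stiefel.toGr_eq {φ : Stiefel m H} {X : Gr m H} (h : ∀ x, φ.1 x ∈ X.1) : φ.toGr = X := by
  have := X.2.1
  refine Subtype.ext (Submodule.eq_of_le_of_finrank_eq ?_ (φ.toGr.2.2.trans X.2.2.symm))
  rintro _ ⟨x, rfl⟩
  exact h x

/-- `φ φ^* v` lies in the image of `φ`, and `φ^*` kills `v - φ φ^* v`, which is therefore orthogonal
to that image. The formula expresses `π` as a smooth map of the ambient spaces. -/
theorem Stiefel.proj_toGr (φ : Stiefel m H) : φ.toGr.proj = φ.1 ∘L φ.1.adjoint := by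
  have := φ.toGr.2.1
  ext v
  refine Submodule.eq_starProjection_of_mem_of_inner_eq_zero (φ.mem_toGr _) ?_
  rintro _ ⟨x, rfl⟩
  rw [ContinuousLinearMap.coe_coe, ← ContinuousLinearMap.adjoint_inner_left, map_sub,
    ContinuousLinearMap.comp_apply, φ.adjoint_apply_apply, sub_self, inner_zero_left]

theorem Gr.exists_toGr_eq (X : Gr m H) : ∃ φ : Stiefel m H, φ.toGr = X := by
  have := X.2.1
  let b : OrthonormalBasis (Fin m) ℂ X.1 :=
    (stdOrthonormalBasis ℂ X.1).reindex (finCongr X.2.2)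
  let L : Cm m →ₗᵢ[ℂ] H := X.1.subtypeₗᵢ.comp b.repr.symm.toLinearIsometry
  have hL : L.toContinuousLinearMap.adjoint ∘L L.toContinuousLinearMap =
      ContinuousLinearMap.id ℂ (Cm m) := by
    ext1 x
    refine ext_inner_right ℂ fun y => ?_
    rw [ContinuousLinearMap.comp_apply, ContinuousLinearMap.adjoint_inner_left]
    exact L.inner_map_map x y
  exact ⟨⟨L.toContinuousLinearMap, hL⟩, Stiefel.toGr_eq fun x => (b.repr.symm x).2⟩

theorem Stiefel.toGr_act (φ : Stiefel m H) (g : Um m) : (φ.act g).toGr = φ.toGr :=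
  Stiefel.toGr_eq fun _ => φ.mem_toGr _

end Subspaces

/-! ### Tangent vectors, the Lie algebra of `U(m)` and the connection form -/

section Tangents

variable {m : ℕ} {H : Type*} [NormedAddCommGroup H] [InnerProductSpace ℂ H] [CompleteSpace H]

theorem mem_skewHermitian {u : Cm m →L[ℂ] Cm m} : u ∈ skewHermitian m ↔ u.adjoint = -u :=
  Iff.rfl

/-- A curve of isometries has velocity `v` with `φ^* v` skew-Hermitian. -/
theorem adjoint_comp_mem_skewHermitian {c : ℝ → Cm m →L[ℂ] H} {v : Cm m →L[ℂ] H}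
    (hc : ∀ t, (c t).adjoint ∘L c t = ContinuousLinearMap.id ℂ (Cm m))
    (hv : HasDerivAt c v 0) : (c 0).adjoint ∘L v ∈ skewHermitian m := by
  have hd : HasDerivAt (fun t => (c t).adjoint ∘L c t)
      ((c 0).adjoint ∘L v + v.adjoint ∘L c 0) 0 := by
    have hB := (isBoundedBilinearMap_comp (𝕜 := ℂ) (E := Cm m) (F := H) (G := Cm m)).hasFDerivAt
      ((c 0).adjoint, c 0)
    have hp : HasDerivAt (fun t => ((c t).adjoint, c t)) (v.adjoint, v) 0 :=
      ((realAdjoint (E := Cm m) (F := H)).hasFDerivAt.comp_hasDerivAt (0 : ℝ) hv).prodMk hv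
    exact (hB.restrictScalars ℝ).comp_hasDerivAt (0 : ℝ) hp
  have h0 : (c 0).adjoint ∘L v + v.adjoint ∘L c 0 = 0 := by
    simp only [hc] at hd
    exact hd.unique (hasDerivAt_const _ _)
  rw [mem_skewHermitian, ContinuousLinearMap.adjoint_comp, ContinuousLinearMap.adjoint_adjoint]
  exact eq_neg_of_add_eq_zero_right h0

theorem Stiefel.form_apply (φ : Stiefel m H) (v : Embedded.tangentSpace Stiefel.incl φ) :
    Stiefel.form φ v = φ.1.adjoint ∘L (v : Cm m →L[ℂ] H) := rfl

/-- The condition is real-linear in `v`, so it suffices to check it on the velocities that span the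
tangent space. -/
theorem Stiefel.form_mem (φ : Stiefel m H) (v : Embedded.tangentSpace Stiefel.incl φ) :
    Stiefel.form φ v ∈ skewHermitian m := by
  have : Embedded.tangentSpace Stiefel.incl φ ≤
      (skewHermitian m).comap (realCompL φ.1.adjoint : (Cm m →L[ℂ] H) →L[ℝ] (Cm m →L[ℂ] Cm m)).toLinearMap := by
    refine Submodule.span_le.2 ?_
    rintro w ⟨c, hc⟩
    have := adjoint_comp_mem_skewHermitian (fun t => (c t).2) hc.velocity
    rwa [hc.start] at this
  exact this v.2

/-- The one-parameter subgroup of `U(m)` generated by a skew-Hermitian endomorphism. -/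
def Um.exp (u : Cm m →L[ℂ] Cm m) (hu : u ∈ skewHermitian m) (t : ℝ) : Um m :=
  ⟨NormedSpace.exp (t • u),
    letI : NormedAlgebra ℚ (Cm m →L[ℂ] Cm m) := NormedAlgebra.restrictScalars ℚ ℝ _
    NormedSpace.exp_mem_unitary_of_mem_skewAdjoint ((skewHermitian m).smul_mem t hu)⟩

theorem Um.exp_zero (u : Cm m →L[ℂ] Cm m) (hu : u ∈ skewHermitian m) : Um.exp u hu 0 = 1 :=
  Subtype.ext ((congrArg NormedSpace.exp (zero_smul ℝ u)).trans NormedSpace.exp_zero)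

theorem Stiefel.act_one (φ : Stiefel m H) : φ.act 1 = φ :=
  Subtype.ext (ContinuousLinearMap.comp_id φ.1)

theorem contDiff_exp_smul {A : Type*} [NormedRing A] [NormedAlgebra ℝ A] [CompleteSpace A]
    (u : A) : ContDiff ℝ ∞ fun t : ℝ => NormedSpace.exp (t • u) := by
  have h : ContDiff ℝ ∞ (NormedSpace.exp : A → A) :=
    contDiff_iff_contDiffAt.2 fun x => (NormedSpace.exp_analytic (𝕂 := ℝ) x).contDiffAt
  exact h.comp (contDiff_id.smul contDiff_const)

theorem hasDerivAt_exp_smul_zero {A : Type*} [NormedRing A] [NormedAlgebra ℝ A] [CompleteSpace A]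
    (u : A) : HasDerivAt (fun t : ℝ => NormedSpace.exp (t • u)) u 0 := by
  simpa using hasDerivAt_exp_smul_const (𝕂 := ℝ) u (0 : ℝ)

theorem Um.hasVelocity_exp (u : Cm m →L[ℂ] Cm m) (hu : u ∈ skewHermitian m) :
    Embedded.HasVelocity (Um.incl m) 1 (Um.exp u hu) u where
  start := Um.exp_zero u hu
  smooth := (contDiff_exp_smul u).contDiffAt
  velocity := hasDerivAt_exp_smul_zero u

theorem Stiefel.hasVelocity_act_exp (φ : Stiefel m H) (u : Cm m →L[ℂ] Cm m)
    (hu : u ∈ skewHermitian m) :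
    Embedded.HasVelocity Stiefel.incl φ (fun t => φ.act (Um.exp u hu t)) (φ.incl ∘L u) where
  start := by rw [Um.exp_zero, φ.act_one]
  smooth := ((realCompL φ.1).contDiff.comp (contDiff_exp_smul u)).contDiffAt
  velocity := (realCompL φ.1).hasFDerivAt.comp_hasDerivAt (0 : ℝ) (hasDerivAt_exp_smul_zero u)

theorem Stiefel.adjoint_comp_incl_comp (φ : Stiefel m H) (u : Cm m →L[ℂ] Cm m) :
    φ.1.adjoint ∘L (φ.incl ∘L u) = u := by
  ext1 x
  exact φ.adjoint_apply_apply (u x)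

theorem Um.adjoint_comp_self (g : Um m) :
    (g : Cm m →L[ℂ] Cm m).adjoint ∘L (g : Cm m →L[ℂ] Cm m) = ContinuousLinearMap.id ℂ (Cm m) := by
  have h : star (g : Cm m →L[ℂ] Cm m) * (g : Cm m →L[ℂ] Cm m) = 1 :=
    Unitary.star_mul_self_of_mem g.2
  exact h

theorem Um.velocity_mem_skewHermitian {c : ℝ → Um m} {w : Cm m →L[ℂ] Cm m}
    (hc : Embedded.HasVelocity (Um.incl m) 1 c w) : w ∈ skewHermitian m := by
  have h := adjoint_comp_mem_skewHermitian (c := fun t => ((c t : Um m) : Cm m →L[ℂ] Cm m))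
    (fun t => Um.adjoint_comp_self (c t)) hc.velocity
  have h0 : ((c 0 : Um m) : Cm m →L[ℂ] Cm m) = ContinuousLinearMap.id ℂ (Cm m) :=
    congrArg Subtype.val hc.start
  simp only [h0, ContinuousLinearMap.adjoint_id, ContinuousLinearMap.id_comp] at h
  exact h

/-- Differentiating `c^* c = 1` at the identity gives one inclusion; the one-parameter groups `exp
(t u)` give the other. -/
theorem lieAlgebra_Um (m : ℕ) : Embedded.lieAlgebra (Um.incl m) = skewHermitian m := by
  apply le_antisymm
  · refine Submodule.span_le.2 ?_
    rintro w ⟨c, hc⟩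
    exact Um.velocity_mem_skewHermitian hc
  · intro u hu
    exact Submodule.subset_span ⟨_, Um.hasVelocity_exp u hu⟩

/-- Right translation by `g` maps velocities to velocities. -/
theorem Stiefel.hasVelocity_act {φ : Stiefel m H} {c : ℝ → Stiefel m H} {v : Cm m →L[ℂ] H}
    (h : Embedded.HasVelocity Stiefel.incl φ c v) (g : Um m) :
    Embedded.HasVelocity Stiefel.incl (φ.act g) (fun t => (c t).act g)
      (v ∘L (g : Cm m →L[ℂ] Cm m)) where
  start := by rw [h.start]
  smooth := (realCompR (G := H) (g : Cm m →L[ℂ] Cm m)).contDiff.contDiffAt.comp (0 : ℝ) h.smooth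
  velocity := (realCompR (G := H) (g : Cm m →L[ℂ] Cm m)).hasFDerivAt.comp_hasDerivAt (0 : ℝ) h.velocity

/-- The differential of right translation by `g`. -/
def Stiefel.actDifferential (φ : Stiefel m H) (g : Um m) :
    Embedded.tangentSpace Stiefel.incl φ →L[ℝ] Embedded.tangentSpace Stiefel.incl (φ.act g) :=
  ((realCompR (g : Cm m →L[ℂ] Cm m)).comp
    (Embedded.tangentSpace Stiefel.incl φ).subtypeL).codRestrict _ fun v => by
      have : Embedded.tangentSpace Stiefel.incl φ ≤
          (Embedded.tangentSpace Stiefel.incl (φ.act g)).comap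
            (realCompR (g : Cm m →L[ℂ] Cm m) : (Cm m →L[ℂ] H) →L[ℝ] (Cm m →L[ℂ] H)).toLinearMap := by
        refine Submodule.span_le.2 ?_
        rintro w ⟨c, hc⟩
        exact Submodule.subset_span ⟨_, Stiefel.hasVelocity_act hc g⟩
      exact this v.2

theorem Stiefel.coe_actDifferential (φ : Stiefel m H) (g : Um m)
    (v : Embedded.tangentSpace Stiefel.incl φ) :
    (φ.actDifferential g v : Cm m →L[ℂ] H) =
      (v : Cm m →L[ℂ] H) ∘L (g : Cm m →L[ℂ] Cm m) := rfl

theorem Stiefel.isDifferentialAt_act (φ : Stiefel m H) (g : Um m) :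
    Embedded.IsDifferentialAt Stiefel.incl Stiefel.incl (fun ψ => ψ.act g) φ
      (φ.actDifferential g) :=
  fun _ _ h => Stiefel.hasVelocity_act h g

theorem Stiefel.form_actDifferential (φ : Stiefel m H) (g : Um m)
    (v : Embedded.tangentSpace Stiefel.incl φ) :
    Stiefel.form (φ.act g) (φ.actDifferential g v) =
      ((g⁻¹ : Um m) : Cm m →L[ℂ] Cm m) ∘L Stiefel.form φ v ∘L (g : Cm m →L[ℂ] Cm m) := by
  have h : (φ.act g).1.adjoint = ((g⁻¹ : Um m) : Cm m →L[ℂ] Cm m) ∘L φ.1.adjoint :=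
    ContinuousLinearMap.adjoint_comp _ _
  rw [Stiefel.form_apply, Stiefel.form_apply, h, Stiefel.coe_actDifferential]
  rfl

theorem contDiff_restrictScalars_clm {E F G : Type*}
    [NormedAddCommGroup E] [NormedSpace ℂ E] [NormedSpace ℝ E] [IsScalarTower ℝ ℂ E]
    [NormedAddCommGroup F] [NormedSpace ℂ F] [NormedSpace ℝ F] [IsScalarTower ℝ ℂ F]
    [NormedAddCommGroup G] [NormedSpace ℂ G] [NormedSpace ℝ G] [IsScalarTower ℝ ℂ G]
    (B : E →L[ℂ] F →L[ℂ] G) : ContDiff ℝ ∞ fun x => (B x).restrictScalars ℝ :=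
  (B.bilinearRestrictScalars ℝ).contDiff

/-- The formula `w ↦ φ^* w` makes sense for every operator `φ` and is real-linear in `φ`, so one
global ambient form extends `A`. Smoothness is over `ℝ` because the adjoint is conjugate-linear. -/
theorem Stiefel.form_isSmooth : (Stiefel.form (m := m) (H := H)).IsSmooth := by
  have h : ContDiff ℝ ∞ fun φ : Cm m →L[ℂ] H =>
      (realCompL φ.adjoint : (Cm m →L[ℂ] H) →L[ℝ] (Cm m →L[ℂ] Cm m)) := by
    exact (contDiff_restrictScalars_clm (ContinuousLinearMap.compL ℂ (Cm m) H (Cm m))).comp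
      (realAdjoint (E := Cm m) (F := H)).contDiff
  exact fun x => ⟨Set.univ, _, isOpen_univ, trivial, h.contDiffOn, fun _ _ _ => rfl⟩

theorem Stiefel.isConnectionForm_form :
    Embedded.IsConnectionForm (Stiefel.incl (m := m) (H := H)) (Um.incl m) Stiefel.act
      Stiefel.form where
  smooth := Stiefel.form_isSmooth
  mem_lieAlgebra p v := by
    rw [lieAlgebra_Um]
    exact p.form_mem v
  pullback g p := ⟨p.actDifferential g, p.isDifferentialAt_act g, p.form_actDifferential g⟩
  fundamental u hu p := by
    rw [lieAlgebra_Um] at hu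
    exact ⟨Um.exp u hu, fun _ => rfl, _, p.hasVelocity_act_exp u hu, p.adjoint_comp_incl_comp u⟩

end Tangents

namespace Embedded

section Smooth

variable {M N E F : Type*} [NormedAddCommGroup E] [NormedSpace ℝ E]
  [NormedAddCommGroup F] [NormedSpace ℝ F] {ι : M → E} {κ : N → F}

theorem Smooth.of_contDiff {f : M → N} {f' : E → F} (hf' : ContDiff ℝ ∞ f')
    (h : ∀ x, κ (f x) = f' (ι x)) : Smooth ι κ f :=
  fun _ _ => ⟨Set.univ, f', isOpen_univ, trivial, hf'.contDiffOn, fun y _ _ => h y⟩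

theorem SmoothOn.of_contDiffOn {f : M → N} {s : Set M} {f' : E → F} {U : Set E} (hU : IsOpen U)
    (hsU : ∀ x ∈ s, ι x ∈ U) (hf' : ContDiffOn ℝ ∞ f' U) (h : ∀ x ∈ s, κ (f x) = f' (ι x)) :
    SmoothOn ι κ f s :=
  fun x hx => ⟨U, f', hU, hsU x hx, hf', fun y hy _ => h y hy⟩

end Smooth

end Embedded

/-! ### Submanifold structures and local triviality -/

section Bundle

/-- The isometries form a submanifold of the space of operators. -/
theorem isSubmanifold_isometries (E F : Type*)
    [NormedAddCommGroup E] [InnerProductSpace ℂ E] [CompleteSpace E]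
    [NormedAddCommGroup F] [InnerProductSpace ℂ F] [CompleteSpace F] :
    Embedded.IsSubmanifold
      {V : E →L[ℂ] F | V.adjoint ∘L V = ContinuousLinearMap.id ℂ E} := by
  obtain ⟨Ω, ρ, hΩ, hρ, hiso, hfix, -⟩ := exists_smooth_polar E F
  exact Embedded.isSubmanifold_of_retraction fun p hp =>
    ⟨Ω, ρ, hΩ, (hfix p hp).1, hρ, hiso, fun x _ hx => (hfix x hx).2⟩

variable {m : ℕ} {H : Type*} [NormedAddCommGroup H] [InnerProductSpace ℂ H] [CompleteSpace H]

theorem Stiefel.isManifoldEmbedding_incl :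
    Embedded.IsManifoldEmbedding (Stiefel.incl (m := m) (H := H)) where
  injective := Stiefel.incl_injective
  isSubmanifold := by
    rw [Stiefel.range_incl]
    exact isSubmanifold_isometries _ _

/-- In finite dimension a left inverse is a right inverse, so isometries of `ℂ^m` are unitary and
the submanifold result for isometries covers `U(m)`. -/
theorem Um.range_incl (m : ℕ) : Set.range (Um.incl m) =
    {g | g.adjoint ∘L g = ContinuousLinearMap.id ℂ (Cm m)} := by
  ext g
  constructor
  · rintro ⟨g, rfl⟩
    exact Um.adjoint_comp_self g
  · intro hg
    have h1 : (g.adjoint : Cm m →ₗ[ℂ] Cm m) * (g : Cm m →ₗ[ℂ] Cm m) = 1 :=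
      congrArg ContinuousLinearMap.toLinearMap hg
    have h2 := mul_eq_one_comm.1 h1
    have h3 : g * star g = 1 := by
      ext1 x
      exact congrArg (fun f : Cm m →ₗ[ℂ] Cm m => f x) h2
    exact ⟨⟨g, Unitary.mem_iff.2 ⟨hg, h3⟩⟩, rfl⟩

theorem Um.isLieGroupEmbedding_incl (m : ℕ) : Embedded.IsLieGroupEmbedding (Um.incl m) where
  isManifold :=
    { injective := Subtype.val_injective
      isSubmanifold := by
        rw [Um.range_incl]
        exact isSubmanifold_isometries _ _ }
  smooth_mul := Embedded.Smooth.of_contDiff contDiff_complex_comp fun _ => rfl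
  smooth_inv := Embedded.Smooth.of_contDiff (realAdjoint (E := Cm m) (F := Cm m)).contDiff
    fun _ => rfl

theorem Stiefel.proj_toGr_comp (φ : Stiefel m H) : φ.toGr.proj ∘L φ.1 = φ.1 := by
  ext1 x
  exact φ.toGr.proj_eq_self (φ.mem_toGr x)

/-- Near the projection onto the image of `φ`, the map `A ↦ ρ(A φ) ρ(A φ)^*` is a smooth retraction
onto the projections of rank `m`. -/
theorem Gr.isManifoldEmbedding_proj :
    Embedded.IsManifoldEmbedding (Gr.proj (m := m) (H := H)) where
  injective := Gr.proj_injective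
  isSubmanifold := by
    obtain ⟨Ω, ρ, hΩ, hρ, hiso, hfix, hfac⟩ := exists_smooth_polar (Cm m) H
    refine Embedded.isSubmanifold_of_retraction ?_
    rintro _ ⟨X, rfl⟩
    obtain ⟨φ, rfl⟩ := X.exists_toGr_eq
    have hc : ContDiff ℝ ∞ fun A : H →L[ℂ] H => A ∘L φ.1 :=
      contDiff_complex_comp.comp (contDiff_id.prodMk contDiff_const)
    have hs : ContDiffOn ℝ ∞ (fun A : H →L[ℂ] H => ρ (A ∘L φ.1))
        ((fun A : H →L[ℂ] H => A ∘L φ.1) ⁻¹' Ω) :=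
      hρ.comp hc.contDiffOn fun A hA => hA
    refine ⟨(fun A : H →L[ℂ] H => A ∘L φ.1) ⁻¹' Ω,
      fun A => ρ (A ∘L φ.1) ∘L (ρ (A ∘L φ.1)).adjoint, hΩ.preimage hc.continuous, ?_,
      hs.complex_comp hs.complex_adjoint, ?_, ?_⟩
    · rw [Set.mem_preimage, Stiefel.proj_toGr_comp]
      exact (hfix φ.1 φ.2).1
    · intro A hA
      exact ⟨Stiefel.toGr ⟨ρ (A ∘L φ.1), hiso _ hA⟩, Stiefel.proj_toGr _⟩
    -- For `A = P_Y` the factorisation `ρ(A φ) = A φ a` puts the image of `ρ(A φ)` inside `Y`, so it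
    -- equals `Y`.
    · rintro _ hA ⟨Y, rfl⟩
      obtain ⟨a, ha⟩ := hfac _ hA
      have hY : Stiefel.toGr ⟨ρ (Y.proj ∘L φ.1), hiso _ hA⟩ = Y :=
        Stiefel.toGr_eq fun x => by
          have h : ρ (Y.proj ∘L φ.1) x = Y.proj (φ.1 (a x)) :=
            congrArg (fun V : Cm m →L[ℂ] H => V x) ha
          exact (congrArg (· ∈ Y.1) h).mpr (Y.proj_mem _)
      have h := Stiefel.proj_toGr ⟨ρ (Y.proj ∘L φ.1), hiso _ hA⟩
      rw [hY] at h
      exact h.symm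

/-- Two isometries with the same image differ by a unitary transformation. -/
theorem Stiefel.exists_act_eq {φ ψ : Stiefel m H} (h : ψ.toGr = φ.toGr) :
    ∃ g : Um m, (g : Cm m →L[ℂ] Cm m) = ψ.1.adjoint ∘L φ.1 ∧ ψ.act g = φ := by
  have hP : ∀ v, ψ.1 (ψ.1.adjoint v) = φ.1 (φ.1.adjoint v) := by
    have := congrArg Gr.proj h
    rw [ψ.proj_toGr, φ.proj_toGr] at this
    exact fun v => congrArg (fun f : H →L[ℂ] H => f v) this
  have hadj : (ψ.1.adjoint ∘L φ.1).adjoint = φ.1.adjoint ∘L ψ.1 := by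
    rw [ContinuousLinearMap.adjoint_comp, ContinuousLinearMap.adjoint_adjoint]
  have h1 : star (ψ.1.adjoint ∘L φ.1) * (ψ.1.adjoint ∘L φ.1) = 1 := by
    rw [ContinuousLinearMap.star_eq_adjoint, hadj]
    ext1 x
    change φ.1.adjoint (ψ.1 (ψ.1.adjoint (φ.1 x))) = x
    rw [hP, φ.adjoint_apply_apply, φ.adjoint_apply_apply]
  have h2 : (ψ.1.adjoint ∘L φ.1) * star (ψ.1.adjoint ∘L φ.1) = 1 := by
    rw [ContinuousLinearMap.star_eq_adjoint, hadj]
    ext1 x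
    change ψ.1.adjoint (φ.1 (φ.1.adjoint (ψ.1 x))) = x
    rw [← hP, ψ.adjoint_apply_apply, ψ.adjoint_apply_apply]
  refine ⟨⟨_, Unitary.mem_iff.2 ⟨h1, h2⟩⟩, rfl, Subtype.ext ?_⟩
  ext1 x
  change ψ.1 (ψ.1.adjoint (φ.1 x)) = φ.1 x
  rw [hP, φ.adjoint_apply_apply]

theorem Stiefel.act_mul (φ : Stiefel m H) (g h : Um m) : φ.act (g * h) = (φ.act g).act h := rfl

theorem Stiefel.act_injective (φ : Stiefel m H) : Function.Injective φ.act := by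
  intro g h hgh
  refine Subtype.ext (ContinuousLinearMap.ext fun x => φ.injective ?_)
  exact congrArg (fun ψ : Stiefel m H => ψ.1 x) hgh

/-- A smooth local section of the bundle projection near the image of `φ₀`. -/
theorem Stiefel.exists_local_section (φ₀ : Stiefel m H) :
    ∃ (O : Set (H →L[ℂ] H)) (f : (H →L[ℂ] H) → Cm m →L[ℂ] H) (s : Gr m H → Stiefel m H),
      IsOpen O ∧ φ₀.toGr.proj ∈ O ∧ ContDiffOn ℝ ∞ f O ∧
      ∀ X : Gr m H, X.proj ∈ O → (s X).1 = f X.proj ∧ (s X).toGr = X := by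
  obtain ⟨Ω, ρ, hΩ, hρ, hiso, hfix, hfac⟩ := exists_smooth_polar (Cm m) H
  have hc : ContDiff ℝ ∞ fun A : H →L[ℂ] H => A ∘L φ₀.1 :=
    contDiff_complex_comp.comp (contDiff_id.prodMk contDiff_const)
  have hs : ∀ X : Gr m H, ∃ ψ : Stiefel m H,
      X.proj ∘L φ₀.1 ∈ Ω → ψ.1 = ρ (X.proj ∘L φ₀.1) ∧ ψ.toGr = X := by
    intro X
    by_cases hX : X.proj ∘L φ₀.1 ∈ Ω
    · refine ⟨⟨_, hiso _ hX⟩, fun _ => ⟨rfl, Stiefel.toGr_eq fun x => ?_⟩⟩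
      obtain ⟨a, ha⟩ := hfac _ hX
      have h : ρ (X.proj ∘L φ₀.1) x = X.proj (φ₀.1 (a x)) :=
        congrArg (fun V : Cm m →L[ℂ] H => V x) ha
      exact (congrArg (· ∈ X.1) h).mpr (X.proj_mem _)
    -- An arbitrary value where the section is not used.
    · exact ⟨φ₀, fun h => absurd h hX⟩
  choose s hs using hs
  refine ⟨(fun A : H →L[ℂ] H => A ∘L φ₀.1) ⁻¹' Ω, fun A => ρ (A ∘L φ₀.1), s,
    hΩ.preimage hc.continuous, ?_, hρ.comp hc.contDiffOn fun A hA => hA, hs⟩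
  rw [Set.mem_preimage, Stiefel.proj_toGr_comp]
  exact (hfix φ₀.1 φ₀.2).1

theorem contDiff_comp_adjoint :
    ContDiff ℝ ∞ fun φ : Cm m →L[ℂ] H => φ ∘L φ.adjoint :=
  contDiff_complex_comp.comp (contDiff_id.prodMk (realAdjoint (E := Cm m) (F := H)).contDiff)

/-- A local section `s` gives everything. The group coordinate `s(π φ)^* φ` is unitary because both
frames span the same subspace, and is smooth because `π φ` is represented by `φ φ^*`. -/
theorem Stiefel.isPrincipalBundle_toGr :
    Embedded.IsPrincipalBundle (Stiefel.incl (m := m) (H := H)) Gr.proj (Um.incl m)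
      Stiefel.toGr Stiefel.act where
  total := Stiefel.isManifoldEmbedding_incl
  base := Gr.isManifoldEmbedding_proj
  group := Um.isLieGroupEmbedding_incl m
  smooth_proj := Embedded.Smooth.of_contDiff contDiff_comp_adjoint Stiefel.proj_toGr
  act_one := Stiefel.act_one
  act_mul := Stiefel.act_mul
  smooth_act := Embedded.Smooth.of_contDiff contDiff_complex_comp fun _ => rfl
  locallyTrivial b := by
    obtain ⟨φ₀, rfl⟩ := b.exists_toGr_eq
    obtain ⟨O, f, s, hO, hφ₀, hf, hs⟩ := φ₀.exists_local_section
    have hτ : ∀ φ : Stiefel m H, ∃ g : Um m, φ.toGr.proj ∈ O →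
        (g : Cm m →L[ℂ] Cm m) = (s φ.toGr).1.adjoint ∘L φ.1 ∧ (s φ.toGr).act g = φ := by
      intro φ
      by_cases hφ : φ.toGr.proj ∈ O
      · obtain ⟨g, hg⟩ := Stiefel.exists_act_eq (hs _ hφ).2
        exact ⟨g, fun _ => hg⟩
      · exact ⟨1, fun h => absurd h hφ⟩
    choose τ hτ using hτ
    refine ⟨Gr.proj ⁻¹' O, fun x => (s x.1).act x.2, τ, hφ₀, ⟨O, hO, rfl⟩, ?_, ?_, ?_,
      fun φ hφ => (hτ φ hφ).2, fun _ _ _ _ => rfl⟩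
    · refine Embedded.SmoothOn.of_contDiffOn
        (f' := fun x : (H →L[ℂ] H) × (Cm m →L[ℂ] Cm m) => f x.1 ∘L x.2)
        (U := Prod.fst ⁻¹' O) (hO.preimage continuous_fst) (fun x hx => hx.1) ?_ ?_
      · exact (hf.comp contDiffOn_fst fun x hx => hx).complex_comp contDiffOn_snd
      · rintro ⟨X, g⟩ ⟨hX, -⟩
        exact congrArg (fun ψ : Cm m →L[ℂ] H => ψ ∘L (g : Cm m →L[ℂ] Cm m)) (hs X hX).1
    · refine Embedded.SmoothOn.of_contDiffOn
        (f' := fun φ : Cm m →L[ℂ] H => (f (φ ∘L φ.adjoint)).adjoint ∘L φ)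
        (U := (fun φ : Cm m →L[ℂ] H => φ ∘L φ.adjoint) ⁻¹' O)
        (hO.preimage contDiff_comp_adjoint.continuous) ?_ ?_ ?_
      · intro φ hφ
        have h : φ.toGr.proj ∈ O := hφ
        rwa [φ.proj_toGr] at h
      · exact (hf.comp contDiff_comp_adjoint.contDiffOn
          fun φ hφ => hφ).complex_adjoint.complex_comp contDiffOn_id
      · intro φ hφ
        have h := (hτ φ hφ).1
        rw [(hs _ hφ).1, φ.proj_toGr] at h
        exact h
    · intro X hX g
      have h1 : ((s X).act g).toGr = X := (Stiefel.toGr_act _ _).trans (hs X hX).2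
      refine ⟨h1, ?_⟩
      -- Both `g` and `τ (s(X) g)` carry `s(X)` to the same frame, so they agree because the action
      -- is free.
      have h2 := (hτ ((s X).act g) (by rw [h1]; exact hX)).2
      rw [h1] at h2
      exact (s X).act_injective h2

end Bundle

end

theorem mainTheorem5 (m : ℕ) (hm : 0 < m) (H : Type*) [NormedAddCommGroup H]
    [InnerProductSpace ℂ H] [CompleteSpace H] :
    -- `A` takes values in the skew-Hermitian endomorphisms, the Lie algebra of `U(m)`
    (∀ (φ : Stiefel m H) (v : Embedded.tangentSpace Stiefel.incl φ),
      Stiefel.form φ v ∈ skewHermitian m) ∧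
    Embedded.lieAlgebra (Um.incl m) = skewHermitian m ∧
    -- `R_g^* A = Ad(g⁻¹) A`, the differential of `R_g` being `v ↦ v ∘ g`
    (∀ (g : Um m) (φ : Stiefel m H),
      ∃ D : Embedded.tangentSpace Stiefel.incl φ →L[ℝ]
          Embedded.tangentSpace Stiefel.incl (φ.act g),
        Embedded.IsDifferentialAt Stiefel.incl Stiefel.incl (fun ψ => ψ.act g) φ D ∧
        ∀ v, (D v : Cm m →L[ℂ] H) = (v : Cm m →L[ℂ] H) ∘L (g : Cm m →L[ℂ] Cm m) ∧
          Stiefel.form (φ.act g) (D v) =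
            ((g⁻¹ : Um m) : Cm m →L[ℂ] Cm m) ∘L Stiefel.form φ v ∘L
              (g : Cm m →L[ℂ] Cm m)) ∧
    -- `A(φ u) = u` for the fundamental vertical vectors `φ u`
    (∀ (φ : Stiefel m H), ∀ u ∈ skewHermitian m,
      ∃ h : φ.incl ∘L u ∈ Embedded.tangentSpace Stiefel.incl φ,
        Stiefel.form φ ⟨φ.incl ∘L u, h⟩ = u) ∧
    -- `A` is a connection form on the principal `U(m)`-bundle `Isom(ℂ^m, H) → Gr_m(H)`
    Embedded.IsPrincipalBundle (Stiefel.incl (m := m) (H := H)) Gr.proj (Um.incl m)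
      Stiefel.toGr Stiefel.act ∧
    Embedded.IsConnectionForm (Stiefel.incl (m := m) (H := H)) (Um.incl m) Stiefel.act
      Stiefel.form := by
  exact ⟨fun φ v => φ.form_mem v, lieAlgebra_Um m,
    fun g φ => ⟨φ.actDifferential g, φ.isDifferentialAt_act g,
      fun v => ⟨φ.coe_actDifferential g v, φ.form_actDifferential g v⟩⟩,
    fun φ u hu => ⟨Submodule.subset_span ⟨_, φ.hasVelocity_act_exp u hu⟩,
      φ.adjoint_comp_incl_comp u⟩,
    Stiefel.isPrincipalBundle_toGr, Stiefel.isConnectionForm_form⟩
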